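/- Let $p$ be a prime and let $R$ be a commutative Noetherian ring of characteristic $p$, with Frobenius map $f(r)=r^p$. Let ${}^{f}\!R$ be the $R$-$R$-bimodule which is $R$ as an additive group, with left action $r\ast s=r^{p}s$ and right action $s\cdot r=sr$. For an $R$-module $M$ put $\mathrm F(M)=M\otimes_R{}^{f}\!R$, with $R$-action $r(x\otimes s)=x\otimes sr$, and $\widetilde{\mathrm F}(M)=\operatorname{Hom}_R({}^{f}\!R,M)$ (homomorphisms for the left structure of ${}^{f}\!R$), with $R$-action $(r\theta)(s)=\theta(sr)$. The ring $R$ is called F-finite if ${}^{f}\!R$ is a finitely generated left $R$-module, and FPI if $\mathrm F(I)$ is injective for every injective $R$-module $I$ (finitely generated or not). An $R$-module $M$ is reflexive if the natural map $M\to\operatorname{Hom}_R(\operatorname{Hom}_R(M,R),R)$ is an isomorphism. An F-finite ring $R$ is called $\widetilde{\mathrm F}$PR if $\widetilde{\mathrm F}(M)$ is reflexive for every finitely generated reflexive $R$-module $M$. Proposition. If $R$ is F-finite and FPI, then $\widetilde{\mathrm F}(M)$ is reflexive for every finitely generated reflexive $R$-module $M$; that is, $R$ is $\widetilde{\mathrm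 F}$PR. -/

import Mathlib

open scoped TensorProduct

universe u v

noncomputable section

/-- The ring `R` regarded as an `R`-`R`-bimodule whose left structure is given by the Frobenius map
and whose right structure is multiplication in `R`. -/
def FrobBimodule (_p : ℕ) (R : Type u) : Type u := R

namespace FrobBimodule

variable (p : ℕ) (R : Type u) [CommRing R]

/-- As a ring (in particular as an additive group) it coincides with `R`. -/
instance : CommRing (FrobBimodule p R) := inferInstanceAs (CommRing R)

/-- The identity map from `R`. -/
def of : R ≃+* FrobBimodule p R := RingEquiv.refl R

variable [ExpChar R p]

/-- The left `R`-action, through the Frobenius map: `r • s = r ^ p * s`. -/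
instance : Algebra R (FrobBimodule p R) :=
  ((of p R).toRingHom.comp (frobenius R p)).toAlgebra

theorem smul_of (r s : R) : r • of p R s = of p R (r ^ p * s) := rfl

/-- The right `R`-action `s ↦ s * r`; each right multiplication is linear for the left action. -/
def rightMul : R →+* Module.End R (FrobBimodule p R) :=
  (Algebra.lmul R (FrobBimodule p R)).toRingHom.comp (of p R).toRingHom

theorem rightMul_of (r s : R) : rightMul p R r (of p R s) = of p R (s * r) := by
  change of p R (r * s) = of p R (s * r)
  rw [mul_comm]

end FrobBimodule

section Functors

variable (p : ℕ) (R : Type u) [CommRing R] [ExpChar R p]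
variable (M : Type v) [AddCommGroup M] [Module R M]

/-- The Peskine-Szpiro (Frobenius) functor on objects: the tensor product of `M` with
`FrobBimodule p R` over the left structure of the latter. Its module structure is given below. -/
def FrobTensor : Type (max v u) := M ⊗[R] FrobBimodule p R

namespace FrobTensor

instance : AddCommGroup (FrobTensor p R M) :=
  inferInstanceAs (AddCommGroup (M ⊗[R] FrobBimodule p R))

/-- The action of `R` on `M ⊗ FrobBimodule p R` through the right structure of the second factor. -/
def action : R →+* Module.End R (M ⊗[R] FrobBimodule p R) where
  toFun r := LinearMap.lTensor M (FrobBimodule.rightMul p R r)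
  map_one' := by rw [map_one]; exact LinearMap.lTensor_id M _
  map_mul' r s := by rw [map_mul]; exact LinearMap.lTensor_mul M _ _
  map_zero' := by rw [map_zero]; exact LinearMap.lTensor_zero M
  map_add' r s := by rw [map_add]; exact LinearMap.lTensor_add M _ _

instance : Module R (FrobTensor p R M) :=
  Module.compHom (M ⊗[R] FrobBimodule p R) (action p R M)

/-- The elementary tensor `x ⊗ s`. -/
def tmul (x : M) (s : R) : FrobTensor p R M :=
  (x ⊗ₜ[R] FrobBimodule.of p R s : M ⊗[R] FrobBimodule p R)

theorem smul_tmul (r s : R) (x : M) : r • tmul p R M x s = tmul p R M x (s * r) := by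
  change LinearMap.lTensor M (FrobBimodule.rightMul p R r) (x ⊗ₜ[R] FrobBimodule.of p R s) = _
  rw [LinearMap.lTensor_tmul, FrobBimodule.rightMul_of]
  rfl

theorem tmul_smul (r s : R) (x : M) : tmul p R M (r • x) s = tmul p R M x (r ^ p * s) :=
  TensorProduct.smul_tmul r x (FrobBimodule.of p R s)

end FrobTensor

/-- The dual Frobenius functor on objects: the maps from `FrobBimodule p R` to `M` that are linear
for the left structure of the former. Its module structure is given below. -/
def FrobHom : Type (max u v) := FrobBimodule p R →ₗ[R] M

namespace FrobHom

instance : AddCommGroup (FrobHom p R M) :=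
  inferInstanceAs (AddCommGroup (FrobBimodule p R →ₗ[R] M))

/-- The value `θ s`. -/
def eval (θ : FrobHom p R M) (s : R) : M :=
  (show FrobBimodule p R →ₗ[R] M from θ) (FrobBimodule.of p R s)

theorem eval_pow_mul (θ : FrobHom p R M) (r s : R) :
    eval p R M θ (r ^ p * s) = r • eval p R M θ s :=
  (show FrobBimodule p R →ₗ[R] M from θ).map_smul r (FrobBimodule.of p R s)

/-- The action of `R` through the right structure of `FrobBimodule p R`:
`(r • θ) s = θ (s * r)`. -/
instance : Module R (FrobHom p R M) where
  smul r θ := (show FrobBimodule p R →ₗ[R] M from θ).comp (FrobBimodule.rightMul p R r)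
  one_smul θ := by
    change LinearMap.comp _ (FrobBimodule.rightMul p R 1) = _
    rw [map_one]; exact LinearMap.comp_id _
  mul_smul r s θ := by
    change LinearMap.comp _ (FrobBimodule.rightMul p R (r * s)) = _
    rw [mul_comm, map_mul]; rfl
  smul_zero r := LinearMap.zero_comp _
  smul_add r θ η := LinearMap.add_comp _ _ _
  zero_smul θ := by
    change LinearMap.comp _ (FrobBimodule.rightMul p R 0) = _
    rw [map_zero]; exact LinearMap.comp_zero _
  add_smul r s θ := by
    change LinearMap.comp _ (FrobBimodule.rightMul p R (r + s)) = _
    rw [map_add]; exact LinearMap.comp_add _ _ _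

theorem eval_smul (r s : R) (θ : FrobHom p R M) :
    eval p R M (r • θ) s = eval p R M θ (s * r) :=
  congrArg (show FrobBimodule p R →ₗ[R] M from θ) (FrobBimodule.rightMul_of p R r s)

end FrobHom

end Functors

section Rings

variable (p : ℕ) (R : Type u) [CommRing R] [ExpChar R p]

/-- `R` is F-finite: it is a finitely generated module over itself through the Frobenius map. -/
def IsFFinite : Prop := Module.Finite R (FrobBimodule p R)

/-- `R` is FPI: the Frobenius functor preserves injective modules (finitely generated or not). -/
def IsFPI : Prop :=
  ∀ (I : Type u) [AddCommGroup I] [Module R I],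
    Module.Injective R I → Module.Injective R (FrobTensor p R I)

/-- An F-finite ring is `F̃`-preserve reflexive: the dual Frobenius functor sends finitely generated
reflexive modules to reflexive modules. -/
def IsFTildePR : Prop :=
  IsFFinite p R ∧
    ∀ (M : Type u) [AddCommGroup M] [Module R M] [Module.Finite R M],
      Module.IsReflexive R M → Module.IsReflexive R (FrobHom p R M)

end Rings

end

/-!
Write `S` for `R` regarded as an `R`-algebra through the Frobenius map, so that
`FrobTensor p R M = M ⊗ S` and `FrobHom p R M = Hom_R(S, M)`. If `M` is reflexive, then
`M = Hom_R(M*, R)`, and the tensor-hom adjunction gives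
`FrobHom p R M = Hom(FrobTensor p R M*, W)` with `W = FrobHom p R R`
(`FrobHom.isReflexive_of_hom`). The result therefore follows from two consequences of FPI.

*The module `W` is finitely generated projective* (`FrobHom.projective_self`). Since `S` is finitely
presented and the character module `I` of `R` is injective, `I ⊗ S` is the character module of `W`.
By FPI it is injective, so `W` is flat.

*The dual of every finitely generated module is reflexive*
(`Module.IsReflexive.dual_of_injective_localization`). This holds as soon as `R_P` is injective over
`R` for each associated prime `P` of `R`, because every functional on `X*` then becomes, after
multiplication by some element outside `P`, evaluation at an element of `X`.

The injectivity of `A = R_P` (`IsAssociatedPrime.injective_localization`) is proved as follows. Let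
`I` be the character module of `A`. As `P` annihilates an element that is nonzero in `A`, there is
a nonzero map from `I` to the residue field. Applying the Frobenius functor `e` times yields an
injective `R`-module `J` with a surjection `J → A / P^[q] A`, where `q = p ^ e`. For an injective
module and a finitely generated ideal `K`, an element of `J` annihilated by `ann K` lies in `K J`.
Since `ann (P^n A)` is constant for large `n`, this gives `P^n J ⊆ P^[q] J`, hence
`P^n A ⊆ P^[q] A ⊆ P^(n+1) A` once `q > n`, and `P^n A = 0` by Nakayama. Now `P^[q] A = 0` for
large `q`, so `J → A` is a surjection; it splits, and `A` is injective.
-/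

section

open Module

/-! ### Injective modules and ideals -/

/-- The annihilator of `ann K` in an injective module `J` is contained in `K J`: if `a` generates
`K`, then the hypothesis says that `r • a ↦ r • y` is well defined, and by injectivity it extends to
a map `g : Rⁿ → J` with `g a = y`. -/
theorem Module.Injective.mem_ideal_smul_top {R : Type u} [CommRing R] {J : Type u}
    [AddCommGroup J] [Module R J] [Module.Injective R J] {K : Ideal R} (hK : K.FG) (y : J)
    (h : ∀ z : R, (∀ a ∈ K, z * a = 0) → z • y = 0) : y ∈ K • (⊤ : Submodule R J) := by
  obtain ⟨n, a, rfl⟩ := Submodule.fg_iff_exists_fin_generating_family.mp hK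
  have ha (i : Fin n) : a i ∈ Submodule.span R (Set.range a) :=
    Submodule.subset_span ⟨i, rfl⟩
  let f : R →ₗ[R] (Fin n → R) := LinearMap.toSpanSingleton R _ a
  have hle : LinearMap.ker f ≤ LinearMap.ker (LinearMap.toSpanSingleton R J y) := by
    intro z hz
    have hz' : ∀ i, z * a i = 0 := fun i => congrFun (LinearMap.mem_ker.mp hz) i
    refine LinearMap.mem_ker.mpr (h z fun b hb => ?_)
    induction hb using Submodule.span_induction with
    | mem x hx => obtain ⟨i, rfl⟩ := hx; exact hz' i
    | zero => exact mul_zero z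
    | add x y _ _ hx hy => rw [mul_add, hx, hy, add_zero]
    | smul c x _ hx => rw [smul_eq_mul, mul_left_comm, hx, mul_zero]
  obtain ⟨g, hg⟩ := Module.Injective.extension_property R J _ _
    ((LinearMap.ker f).liftQ f le_rfl)
    (LinearMap.ker_eq_bot.mp (Submodule.ker_liftQ_eq_bot _ _ _ le_rfl))
    ((LinearMap.ker f).liftQ (LinearMap.toSpanSingleton R J y) hle)
  have h1 : g a = y := by
    have h2 : g (f 1) = LinearMap.toSpanSingleton R J y 1 :=
      LinearMap.congr_fun hg (Submodule.Quotient.mk 1)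
    simpa [f] using h2
  have h2 : y = ∑ i, g (a i • fun j => if i = j then 1 else 0) := by
    rw [← map_sum, ← pi_eq_sum_univ a, h1]
  rw [h2]
  refine Submodule.sum_mem _ fun i _ => ?_
  rw [map_smul]
  exact Submodule.smul_mem_smul (ha i) trivial

/-! ### Reflexivity of duals -/

/-- The map `X*** → X*` induced by `X → X**` is split surjective, so reflexivity of `X*` means that
a functional on `X**` vanishing on the image of `X` is zero. -/
theorem Module.IsReflexive.dual_of_injective_localization {R : Type u} [CommRing R]
    [IsNoetherianRing R]
    (h : ∀ (P : Ideal R) [P.IsPrime], IsAssociatedPrime P R →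
      Module.Injective R (Localization.AtPrime P))
    (X : Type v) [AddCommGroup X] [Module R X] [Module.Finite R X] :
    Module.IsReflexive R (Dual R X) := by
  have key : ∀ g : Dual R (Dual R (Dual R X)), (∀ x, g (Dual.eval R X x) = 0) → g = 0 := by
    intro g hg
    ext ψ
    by_contra hne
    obtain ⟨P, hP, hle⟩ := exists_le_isAssociatedPrime_of_isNoetherianRing R (g ψ) hne
    have := hP.isPrime
    have := h P hP
    obtain ⟨n, x, hx⟩ := Module.Finite.exists_fin (R := R) (M := X)
    -- `ι` embeds the dual in a free module, so `ψ`, viewed with values in the localization, extends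
    -- to this free module: it becomes evaluation at a combination of the `x i`.
    let ι : Dual R X →ₗ[R] (Fin n → R) := LinearMap.pi fun i => Dual.eval R X (x i)
    have hι : Function.Injective ι := by
      intro f₁ f₂ hf
      exact LinearMap.ext_on_range hx fun i => congrFun hf i
    obtain ⟨Ψ, hΨ⟩ := Module.Injective.extension_property R (Localization.AtPrime P) _ _ ι hι
      (Algebra.linearMap R (Localization.AtPrime P) ∘ₗ ψ)
    classical
    -- `b` is a common denominator of the coefficients of that combination.
    obtain ⟨b, hb⟩ := IsLocalization.exist_integer_multiples_of_finset P.primeCompl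
      (Finset.univ.image fun i => Ψ (Pi.single i 1))
    choose c hc using fun i => hb (Ψ (Pi.single i 1))
      (Finset.mem_image_of_mem _ (Finset.mem_univ i))
    let w : X := ∑ i, c i • x i
    have hw (f : Dual R X) : algebraMap R (Localization.AtPrime P) ((b : R) * ψ f - f w) = 0 := by
      have h1 := LinearMap.congr_fun hΨ f
      rw [LinearMap.comp_apply, LinearMap.comp_apply, Algebra.linearMap_apply,
        pi_eq_sum_univ' (ι f), map_sum] at h1
      rw [map_sub, map_mul, ← h1, Finset.mul_sum, sub_eq_zero, map_sum, map_sum]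
      refine Finset.sum_congr rfl fun i _ => ?_
      have h2 : (ι f) i = f (x i) := rfl
      rw [map_smul, map_smul, h2, smul_eq_mul, map_mul, hc i, Algebra.smul_def, Algebra.smul_def]
      ring
    -- Finite generation of the dual of `X` yields one `t` that works for every `f`.
    have hfg : ∃ t ∈ P.primeCompl, ∀ f : Dual R X, t * ((b : R) * ψ f - f w) = 0 := by
      obtain ⟨m, φ, hφ⟩ := Module.Finite.exists_fin (R := R) (M := Dual R X)
      choose t ht using fun j => (IsLocalization.map_eq_zero_iff P.primeCompl
        (Localization.AtPrime P) _).mp (hw (φ j))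
      refine ⟨∏ j, (t j : R), Submonoid.prod_mem _ fun j _ => (t j).2, fun f => ?_⟩
      have : (∏ j, (t j : R)) • ((b : R) • ψ - Dual.eval R X w) = 0 := by
        refine LinearMap.ext_on_range hφ fun j => ?_
        obtain ⟨d, hd⟩ := Finset.dvd_prod_of_mem (fun j => (t j : R)) (Finset.mem_univ j)
        have := ht j
        simp only [LinearMap.smul_apply, LinearMap.sub_apply, smul_eq_mul, Dual.eval_apply,
          LinearMap.zero_apply]
        rw [hd, mul_right_comm, this, zero_mul]
      simpa using LinearMap.congr_fun this f
    obtain ⟨t, htP, ht⟩ := hfg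
    have hψ : (t * b) • ψ = Dual.eval R X (t • w) := by
      ext f
      have := ht f
      rw [mul_sub, sub_eq_zero, ← mul_assoc] at this
      simpa using this
    have : (t * b) • g ψ = 0 := by rw [← map_smul, hψ, hg]
    exact P.primeCompl.mul_mem htP b.2 (hle (by simpa [Submodule.mem_colon_singleton] using this))
  constructor
  constructor
  · intro f₁ f₂ hf
    ext x
    exact LinearMap.congr_fun hf (Dual.eval R X x)
  · intro g
    refine ⟨g ∘ₗ Dual.eval R X, (sub_eq_zero.mp (key _ fun x => ?_))⟩
    simp

/-! ### The Frobenius functor -/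

noncomputable section

namespace FrobTensor

variable {p : ℕ} {R : Type u} [CommRing R] [ExpChar R p] {M : Type v} [AddCommGroup M] [Module R M]

@[elab_as_elim]
theorem induction_on {motive : FrobTensor p R M → Prop} (z : FrobTensor p R M)
    (zero : motive 0) (tmul : ∀ x s, motive (tmul p R M x s))
    (add : ∀ z w, motive z → motive w → motive (z + w)) : motive z :=
  TensorProduct.induction_on (motive := motive) z zero tmul add

/-- The linear map `x ⊗ s ↦ s • f x` out of the Frobenius functor induced by a map `f` which is
semilinear along the Frobenius endomorphism. -/
def lift {N : Type*} [AddCommGroup N] [Module R N] (f : M →+ N)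
    (hf : ∀ (r : R) (x : M), f (r • x) = r ^ p • f x) : FrobTensor p R M →ₗ[R] N :=
  let τ : FrobTensor p R M →+ N := TensorProduct.liftAddHom
    (AddMonoidHom.mk' (fun x => AddMonoidHom.mk'
        (fun s : FrobBimodule p R => (FrobBimodule.of p R).symm s • f x)
        fun s t => by rw [map_add, add_smul])
      fun x x' => AddMonoidHom.ext fun s => by
        change (FrobBimodule.of p R).symm s • f (x + x') = (FrobBimodule.of p R).symm s • f x +
          (FrobBimodule.of p R).symm s • f x'
        rw [map_add, smul_add])
    fun r x s => by
      change (FrobBimodule.of p R).symm s • f (r • x) = (r ^ p * (FrobBimodule.of p R).symm s) • f x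
      rw [hf, mul_comm, mul_smul]
  { τ with
    map_smul' := fun r z => by
      change τ (r • z) = r • τ z
      induction z using induction_on with
      | zero => rw [smul_zero, map_zero, smul_zero]
      | tmul x s =>
        rw [smul_tmul]
        change (s * r) • f x = r • s • f x
        rw [mul_comm, mul_smul]
      | add z w hz hw => rw [smul_add, map_add, hz, hw, map_add, smul_add] }

theorem lift_tmul {N : Type*} [AddCommGroup N] [Module R N] (f : M →+ N)
    (hf : ∀ (r : R) (x : M), f (r • x) = r ^ p • f x) (x : M) (s : R) :
    lift f hf (tmul p R M x s) = s • f x := rfl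

theorem tmul_add (x : M) (s t : R) :
    tmul p R M x (s + t) = tmul p R M x s + tmul p R M x t :=
  TensorProduct.tmul_add x (FrobBimodule.of p R s) (FrobBimodule.of p R t)

theorem add_tmul (x y : M) (s : R) :
    tmul p R M (x + y) s = tmul p R M x s + tmul p R M y s :=
  TensorProduct.add_tmul x y (FrobBimodule.of p R s)

/-- The action of the Frobenius functor on linear maps, `x ⊗ s ↦ g x ⊗ s`. -/
def map {N : Type*} [AddCommGroup N] [Module R N] (g : M →ₗ[R] N) :
    FrobTensor p R M →ₗ[R] FrobTensor p R N :=
  lift (AddMonoidHom.mk' (fun x => tmul p R N (g x) 1) fun x y => by rw [map_add, add_tmul])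
    fun r x => by
      change tmul p R N (g (r • x)) 1 = r ^ p • tmul p R N (g x) 1
      rw [map_smul, tmul_smul, smul_tmul, mul_comm]

theorem map_tmul {N : Type*} [AddCommGroup N] [Module R N] (g : M →ₗ[R] N) (x : M) (s : R) :
    map (p := p) g (tmul p R M x s) = tmul p R N (g x) s := by
  refine (lift_tmul _ _ x s).trans ?_
  change s • tmul p R N (g x) 1 = _
  rw [smul_tmul, one_mul]

/-- The map induced by multiplication by `t` on `M` is multiplication by `t ^ p`; hence `t ^ p`, and
with it `t`, acts bijectively on the tensor product. -/
theorem bijective_smul {t : R} (hp : p ≠ 0) (h : Function.Bijective fun x : M => t • x) :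
    Function.Bijective fun z : FrobTensor p R M => t • z := by
  let e : M ≃ₗ[R] M := LinearEquiv.ofBijective (LinearMap.lsmul R M t) h
  have he (x : M) : t • e.symm x = x := e.apply_symm_apply x
  have hG (z : FrobTensor p R M) : t ^ p • map e.symm.toLinearMap z = z := by
    induction z using induction_on with
    | zero => rw [map_zero, smul_zero]
    | tmul x s =>
      rw [map_tmul, smul_tmul, mul_comm, ← tmul_smul]
      exact congrArg (fun y => tmul p R M y s) (he x)
    | add z w hz hw => rw [map_add, smul_add, hz, hw]
  obtain ⟨k, rfl⟩ := Nat.exists_eq_succ_of_ne_zero hp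
  constructor
  · intro z w hzw
    have hzw' : t • z = t • w := hzw
    rw [← hG z, ← hG w, ← map_smul, ← map_smul, pow_succ, mul_smul, mul_smul, hzw']
  · intro z
    refine ⟨t ^ k • map e.symm.toLinearMap z, ?_⟩
    change t • _ = z
    rw [smul_smul, ← pow_succ', hG]

end FrobTensor

/-! ### Localizations at associated primes -/

section Localization

variable {R : Type u} [CommRing R]

/-- For `A` the localization of `R` at a prime `P` and an ideal `K` of `R`: there is an injective
`R`-module `J`, on which the elements outside `P` act bijectively, together with an `R`-linear map
`J → A / K A` whose range contains `1`. (As `J` is then an `A`-module, the map is surjective.) -/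
def IsQuotientOfInjective (P K : Ideal R) (A : Type u) [CommRing A] [Algebra R A] : Prop :=
  ∃ (J : Type u) (_ : AddCommGroup J) (_ : Module R J), Module.Injective R J ∧
    (∀ t ∉ P, Function.Bijective fun y : J => t • y) ∧
    ∃ (π : J →ₗ[R] A ⧸ K.map (algebraMap R A)) (y : J), π y = 1

/-- The injective module is the character module `I` of the localization `A`. With `m = P A`, the
module `I / m I` is nonzero: a character in `m I` vanishes on every element annihilated by `m`. -/
theorem isQuotientOfInjective_self [IsNoetherianRing R] (P : Ideal R) [P.IsPrime]
    (hP : IsAssociatedPrime P R) (A : Type u) [CommRing A] [Algebra R A]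
    [IsLocalization.AtPrime A P] : IsQuotientOfInjective P P A := by
  obtain ⟨-, s, hs⟩ := isAssociatedPrime_iff.mp hP
  have hs0 : algebraMap R A s ≠ 0 := by
    intro h0
    obtain ⟨t, ht⟩ := (IsLocalization.map_eq_zero_iff P.primeCompl A s).mp h0
    refine t.2 (hs.ge ?_)
    simpa [Submodule.mem_colon_singleton] using ht
  have : Module.Flat R A := IsLocalization.flat A P.primeCompl
  have hinj : Module.Injective R (CharacterModule A) :=
    Module.Flat.iff_characterModule_injective.mp inferInstance
  obtain ⟨χ, hχ⟩ := CharacterModule.exists_character_apply_ne_zero_of_ne_zero hs0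
  have := IsLocalization.AtPrime.isLocalRing A P
  let m := P.map (algebraMap R A)
  have hm : m = IsLocalRing.maximalIdeal A := IsLocalization.AtPrime.map_eq_maximalIdeal P A
  have hmax : m.IsMaximal := hm ▸ inferInstance
  let I := CharacterModule A
  let N := I ⧸ (m • (⊤ : Submodule A I))
  have hχm : χ ∉ m • (⊤ : Submodule A I) := by
    intro hmem
    apply hχ
    have hms : ∀ a ∈ m, a * algebraMap R A s = 0 := by
      intro a ha
      refine Submodule.span_induction (fun x hx => ?_) (zero_mul _)
        (fun x y _ _ hx hy => by rw [add_mul, hx, hy, add_zero])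
        (fun c x _ hx => by rw [smul_eq_mul, mul_assoc, hx, mul_zero]) ha
      obtain ⟨r, hr, rfl⟩ := hx
      have hr' : r ∈ P := hr
      rw [hs] at hr'
      have : r * s = 0 := by simpa [Submodule.mem_colon_singleton] using hr'
      rw [← map_mul, this, map_zero]
    refine Submodule.smul_induction_on hmem (fun a ha ξ _ => ?_) (fun x y hx hy => ?_)
    · rw [CharacterModule.smul_apply, smul_eq_mul, hms a ha, map_zero]
    · change x _ + y _ = 0
      rw [hx, hy, add_zero]
  let _ : Field (A ⧸ m) := Ideal.Quotient.field m
  have hne : (Submodule.Quotient.mk χ : N) ≠ 0 := by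
    rwa [Ne, Submodule.Quotient.mk_eq_zero]
  obtain ⟨l, hl⟩ : ∃ l : Dual (A ⧸ m) N, l (Submodule.Quotient.mk χ) ≠ 0 := by
    by_contra! hcon
    exact hne ((forall_dual_apply_eq_zero_iff (A ⧸ m) _).mp hcon)
  let lA : I →ₗ[A] A ⧸ m := l.restrictScalars A ∘ₗ Submodule.mkQ _
  obtain ⟨a, ha⟩ := Ideal.Quotient.mk_surjective (l (Submodule.Quotient.mk χ))⁻¹
  refine ⟨I, inferInstance, inferInstance, hinj, fun t ht => ?_,
    { toFun := lA, map_add' := map_add lA, map_smul' := fun r ξ => ?_ }, a • χ, ?_⟩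
  · have hu : IsUnit (algebraMap R A t) := IsLocalization.map_units A (⟨t, ht⟩ : P.primeCompl)
    have : (fun y : I => t • y) = fun y : I => hu.unit • y := by
      funext y
      ext b
      change y (t • b) = y (algebraMap R A t • b)
      rw [algebraMap_smul]
    rw [this]
    exact MulAction.bijective _
  · have : r • ξ = algebraMap R A r • ξ := by
      ext b
      change ξ (r • b) = ξ (algebraMap R A r • b)
      rw [algebraMap_smul]
    rw [this, map_smul, RingHom.id_apply, algebraMap_smul]
  · change lA (a • χ) = 1
    rw [map_smul, Algebra.smul_def]
    change Ideal.Quotient.mk m a * l (Submodule.Quotient.mk χ) = 1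
    rw [ha, inv_mul_cancel₀ hl]

/-- A map `π : J → A / K A` induces the map `x ⊗ s ↦ s • φ (π x)` on the Frobenius functor, where
`φ` is induced by the Frobenius map of `A`. -/
theorem IsQuotientOfInjective.map_frobenius {p : ℕ} [ExpChar R p] (hFPI : IsFPI p R)
    {P K : Ideal R} {A : Type u} [CommRing A] [Algebra R A] [ExpChar A p]
    (h : IsQuotientOfInjective P K A) :
    IsQuotientOfInjective P (K.map (frobenius R p)) A := by
  obtain ⟨J, _, _, hJ, hbij, π, y, hy⟩ := h
  let φ : A ⧸ K.map (algebraMap R A) →+* A ⧸ (K.map (frobenius R p)).map (algebraMap R A) :=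
    Ideal.quotientMap _ (frobenius A p) <| by
      refine Ideal.map_le_iff_le_comap.mpr fun x hx => ?_
      change frobenius A p (algebraMap R A x) ∈ (K.map (frobenius R p)).map (algebraMap R A)
      rw [← RingHom.map_frobenius]
      exact Ideal.mem_map_of_mem _ (Ideal.mem_map_of_mem _ hx)
  have hφ (r : R) (b) : φ (r • b) = r ^ p • φ b := by
    obtain ⟨b, rfl⟩ := Ideal.Quotient.mk_surjective b
    rw [← Ideal.Quotient.mkₐ_eq_mk R, ← map_smul]
    change Ideal.Quotient.mkₐ R _ ((r • b) ^ p) = r ^ p • Ideal.Quotient.mkₐ R _ (b ^ p)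
    rw [← map_smul, smul_pow]
  refine ⟨FrobTensor p R J, inferInstance, inferInstance, hFPI J hJ,
    fun t ht => FrobTensor.bijective_smul (expChar_ne_zero R p) (hbij t ht),
    FrobTensor.lift (φ.toAddMonoidHom.comp π.toAddMonoidHom) fun r x => ?_,
    FrobTensor.tmul p R J y 1, ?_⟩
  · change φ (π (r • x)) = r ^ p • φ (π x)
    rw [map_smul, hφ]
  · rw [FrobTensor.lift_tmul, one_smul]
    change φ (π y) = 1
    rw [hy, map_one]

/-- Applying the Frobenius functor `e` times to the module for `K = P` handles the Frobenius power
`K = P^[p^e]`, which has the same radical as `P` and is contained in `P ^ (p ^ e)`. -/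
theorem IsAssociatedPrime.exists_isQuotientOfInjective_le_pow [IsNoetherianRing R] {p : ℕ}
    [Fact p.Prime] [CharP R p] (hFPI : IsFPI p R) {P : Ideal R} [P.IsPrime]
    (hP : IsAssociatedPrime P R) (A : Type u) [CommRing A] [Algebra R A]
    [IsLocalization.AtPrime A P] [CharP A p] (n : ℕ) :
    ∃ K : Ideal R, K ≤ P ^ (n + 1) ∧ P ≤ K.radical ∧ IsQuotientOfInjective P K A := by
  induction n with
  | zero => exact ⟨P, by simp, Ideal.le_radical, isQuotientOfInjective_self P hP A⟩
  | succ n ih =>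
    obtain ⟨K, hKP, hPK, hK⟩ := ih
    refine ⟨K.map (frobenius R p), Ideal.map_le_iff_le_comap.mpr fun x hx => ?_, fun x hx => ?_,
      hK.map_frobenius hFPI⟩
    · change x ^ p ∈ P ^ (n + 1 + 1)
      refine Ideal.pow_le_pow_right ?_ (pow_mul P (n + 1) p ▸ Ideal.pow_mem_pow (hKP hx) p)
      have := (Fact.out : p.Prime).two_le
      nlinarith
    · obtain ⟨k, hk⟩ := hPK hx
      refine ⟨k * p, ?_⟩
      rw [pow_mul]
      exact Ideal.mem_map_of_mem (frobenius R p) hk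

/-- The localization of `R` at an associated prime `P` is injective. First `P` is shown to be
nilpotent in the localization; a surjection from an injective module onto `A / K A = A` then
exhibits `A` as a direct summand. -/
theorem IsAssociatedPrime.injective_localization [IsNoetherianRing R] {p : ℕ} [Fact p.Prime]
    [CharP R p] (hFPI : IsFPI p R) {P : Ideal R} [P.IsPrime] (hP : IsAssociatedPrime P R)
    (A : Type u) [CommRing A] [Algebra R A] [IsLocalization.AtPrime A P] :
    Module.Injective R A := by
  have := IsLocalization.AtPrime.isLocalRing A P
  have := IsLocalization.isNoetherianRing P.primeCompl A inferInstance
  have : CharP A p := (CharP.charP_iff_prime_eq_zero Fact.out).mpr <| by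
    rw [← map_natCast (algebraMap R A), CharP.cast_eq_zero, map_zero]
  let m : Ideal A := P.map (algebraMap R A)
  have hm : m = IsLocalRing.maximalIdeal A := IsLocalization.AtPrime.map_eq_maximalIdeal P A
  have hK := hP.exists_isQuotientOfInjective_le_pow hFPI A
  -- The annihilators of the powers of `m` form an ascending chain.
  obtain ⟨n, hn⟩ : ∃ n, ∀ k, n ≤ k →
      Submodule.annihilator (m ^ n) = Submodule.annihilator (m ^ k) :=
    monotone_stabilizes_iff_noetherian.mpr inferInstance
      ⟨fun k => Submodule.annihilator (m ^ k), fun a b hab =>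
        Submodule.annihilator_mono (Ideal.pow_le_pow_right hab)⟩
  have hmn : m ^ n = ⊥ := by
    obtain ⟨K, hKP, hPK, J, _, _, hJ, hbij, π, y, hy⟩ := hK n
    -- Every `z` with `z K = 0` annihilates a power of `m`, hence `m ^ n`; so `P ^ n • y` lies
    -- in `K J`, and applying `π` shows that `P ^ n` is contained in `K A`.
    have hle : P ^ n ≤ (K.map (algebraMap R A)).comap (algebraMap R A) := by
      intro x hx
      obtain ⟨N, hN⟩ := Ideal.exists_pow_le_of_le_radical_of_fg hPK P.fg_of_isNoetherianRing
      have hxy : x • y ∈ K • (⊤ : Submodule R J) := by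
        refine Module.Injective.mem_ideal_smul_top K.fg_of_isNoetherianRing _ fun z hz => ?_
        have h1 : algebraMap R A z ∈ Submodule.annihilator (m ^ n) := by
          rw [hn (max n N) (le_max_left _ _)]
          refine Submodule.annihilator_mono (Ideal.pow_le_pow_right (le_max_right n N)) ?_
          rw [← Ideal.map_pow]
          refine Submodule.mem_annihilator.mpr fun a ha => ?_
          refine Submodule.span_induction (fun b hb => ?_) (smul_zero _)
            (fun b c _ _ hb hc => by rw [smul_add, hb, hc, add_zero])
            (fun c b _ hb => by rw [smul_comm, hb, smul_zero]) ha
          obtain ⟨b, hb, rfl⟩ := hb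
          rw [smul_eq_mul, ← map_mul, hz b (hN hb), map_zero]
        have h2 : algebraMap R A (z * x) = 0 := by
          rw [map_mul]
          refine Submodule.mem_annihilator.mp h1 _ ?_
          rw [← Ideal.map_pow]
          exact Ideal.mem_map_of_mem _ hx
        -- `t • z • x • y = 0` for some `t` outside `P`, and `t` acts injectively on `J`.
        obtain ⟨t, ht⟩ := (IsLocalization.map_eq_zero_iff P.primeCompl A _).mp h2
        refine (hbij t t.2).1 ?_
        simp only [smul_zero]
        rw [smul_smul, smul_smul, mul_assoc, ht, zero_smul]
      have h3 : ∀ w ∈ K • (⊤ : Submodule R J), π w = 0 := by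
        intro w hw
        refine Submodule.smul_induction_on hw (fun a ha b _ => ?_) fun u v hu hv => ?_
        · obtain ⟨c, hc⟩ := Ideal.Quotient.mk_surjective (π b)
          rw [map_smul, ← hc, ← Ideal.Quotient.mkₐ_eq_mk R, ← map_smul, Ideal.Quotient.mkₐ_eq_mk,
            Ideal.Quotient.eq_zero_iff_mem, Algebra.smul_def]
          exact Ideal.mul_mem_right _ _ (Ideal.mem_map_of_mem _ ha)
        · rw [map_add, hu, hv, add_zero]
      have h4 := h3 _ hxy
      rw [map_smul, hy, ← map_one (Ideal.Quotient.mkₐ R _), ← map_smul, Ideal.Quotient.mkₐ_eq_mk,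
        Ideal.Quotient.eq_zero_iff_mem, Algebra.smul_def, mul_one] at h4
      exact h4
    -- Nakayama's lemma applies to `m ^ n`, as `K ≤ P ^ (n + 1)`.
    have hle' : m ^ n ≤ m * m ^ n := by
      rw [← pow_succ', ← Ideal.map_pow, ← Ideal.map_pow]
      exact (Ideal.map_le_iff_le_comap.mpr hle).trans (Ideal.map_mono hKP)
    refine Submodule.eq_bot_of_le_smul_of_le_jacobson_bot m (m ^ n)
      (m ^ n).fg_of_isNoetherianRing hle' ?_
    rw [hm, IsLocalRing.jacobson_eq_maximalIdeal _ bot_ne_top]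
  obtain ⟨K, hKP, hPK, J, _, _, hJ, hbij, π, y, hy⟩ := hK n
  have hK0 : K.map (algebraMap R A) = ⊥ := by
    rw [eq_bot_iff, ← hmn, ← Ideal.map_pow]
    exact Ideal.map_mono (hKP.trans (Ideal.pow_le_pow_right n.le_succ))
  have hunit (x : P.primeCompl) : IsUnit (algebraMap R (Module.End R J) x) :=
    (Module.End.isUnit_iff _).mpr (hbij x x.2)
  -- The map `A → J` with `1 ↦ y` exists because the elements outside `P` act invertibly on `J`.
  let ι : A →ₗ[R] J := IsLocalizedModule.lift P.primeCompl (Algebra.linearMap R A)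
    (LinearMap.toSpanSingleton R J y) hunit
  let q : (A ⧸ K.map (algebraMap R A)) →ₗ[R] A :=
    ((Submodule.quotEquivOfEqBot _ hK0).toLinearMap).restrictScalars R
  have hι : ι 1 = y := by
    have := LinearMap.congr_fun (IsLocalizedModule.lift_comp P.primeCompl (Algebra.linearMap R A)
      (LinearMap.toSpanSingleton R J y) hunit) 1
    simpa [ι] using this
  have hid : q ∘ₗ π ∘ₗ ι = LinearMap.id := by
    refine IsLocalizedModule.linearMap_ext P.primeCompl (Algebra.linearMap R A)
      (Algebra.linearMap R A) ?_
    ext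
    have : q 1 = 1 := rfl
    simp [hι, hy, this]
  refine ⟨fun X Y _ _ _ _ f hf g => ?_⟩
  obtain ⟨h, hh⟩ := hJ.out f hf (ι ∘ₗ g)
  refine ⟨q ∘ₗ π ∘ₗ h, fun x => ?_⟩
  have := LinearMap.congr_fun hid (g x)
  simpa [hh] using this

end Localization

/-! ### The dual Frobenius functor -/

namespace FrobHom

variable {p : ℕ} {R : Type u} [CommRing R] [ExpChar R p] {M : Type v} [AddCommGroup M] [Module R M]

theorem ext {θ η : FrobHom p R M} (h : ∀ s, eval p R M θ s = eval p R M η s) : θ = η :=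
  LinearMap.ext (f := (θ : FrobBimodule p R →ₗ[R] M)) (g := η) h

theorem add_eval (θ η : FrobHom p R M) (s : R) :
    eval p R M (θ + η) s = eval p R M θ s + eval p R M η s := rfl

/-- The element of `FrobHom p R M` given by an additive map that is linear along the Frobenius
endomorphism. -/
def mk (f : R →+ M) (hf : ∀ r s, f (r ^ p * s) = r • f s) : FrobHom p R M :=
  ({ toFun := f
     map_add' := map_add f
     map_smul' := hf } : FrobBimodule p R →ₗ[R] M)

/-- The action of the dual Frobenius functor on linear maps, by composition. -/
def map {N : Type*} [AddCommGroup N] [Module R N] (g : M →ₗ[R] N) :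
    FrobHom p R M →ₗ[R] FrobHom p R N where
  toFun θ := g.comp (θ : FrobBimodule p R →ₗ[R] M)
  map_add' _ _ := LinearMap.comp_add _ _ _
  map_smul' _ _ := rfl

theorem eval_map {N : Type*} [AddCommGroup N] [Module R N] (g : M →ₗ[R] N) (θ : FrobHom p R M)
    (s : R) : eval p R N (map g θ) s = g (eval p R M θ s) := rfl

/-- Finiteness over the left structure implies finiteness over the right structure, since the
action of `r` through the former is that of `r ^ p` through the latter. -/
theorem finite_self [IsNoetherianRing R] (hfin : IsFFinite p R) :
    Module.Finite R (FrobHom p R R) := by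
  have : Module.Finite R (FrobBimodule p R) := hfin
  obtain ⟨n, w, hw⟩ := Module.Finite.exists_fin (R := R) (M := FrobBimodule p R →ₗ[R] R)
  let c (η : FrobBimodule p R →ₗ[R] R) : FrobHom p R R := η
  let S : Submodule R (FrobHom p R R) := Submodule.span R (Set.range fun i => c (w i))
  have hc (η) (hη : η ∈ Submodule.span R (Set.range w)) : c η ∈ S := by
    induction hη using Submodule.span_induction with
    | mem η hη =>
      obtain ⟨i, rfl⟩ := hη
      exact Submodule.subset_span ⟨i, rfl⟩
    | zero => exact S.zero_mem
    | add _ _ _ _ hη hξ => exact S.add_mem hη hξ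
    | smul a η _ hη =>
      have h : c (a • η) = a ^ p • c η := ext fun s => by
        rw [eval_smul, mul_comm, eval_pow_mul]
        rfl
      exact h ▸ S.smul_mem _ hη
  have hS : S = ⊤ := eq_top_iff.mpr fun θ _ => hc θ (hw ▸ trivial)
  exact ⟨hS ▸ Submodule.fg_span (Set.finite_range _)⟩

end FrobHom

theorem FrobTensor.finite {p : ℕ} {R : Type u} [CommRing R] [ExpChar R p] {M : Type v}
    [AddCommGroup M] [Module R M] [Module.Finite R M] : Module.Finite R (FrobTensor p R M) := by
  classical
  obtain ⟨n, x, hx⟩ := Module.Finite.exists_fin (R := R) (M := M)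
  refine ⟨⟨Finset.univ.image fun i => tmul p R M (x i) 1, eq_top_iff.mpr fun z _ => ?_⟩⟩
  have h1 (y : M) : tmul p R M y 1 ∈ Submodule.span R
      (Finset.univ.image (fun i => tmul p R M (x i) 1) : Set (FrobTensor p R M)) := by
    have hy : y ∈ Submodule.span R (Set.range x) := hx ▸ trivial
    induction hy using Submodule.span_induction with
    | mem y hy =>
      obtain ⟨i, rfl⟩ := hy
      exact Submodule.subset_span (by simp)
    | zero =>
      have : tmul p R M 0 1 = 0 := TensorProduct.zero_tmul M (FrobBimodule.of p R 1)
      rw [this]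
      exact Submodule.zero_mem _
    | add y z _ _ hy hz => rw [add_tmul]; exact Submodule.add_mem _ hy hz
    | smul c y _ hy =>
      rw [tmul_smul, mul_comm, ← smul_tmul]
      exact Submodule.smul_mem _ _ hy
  induction z using induction_on with
  | zero => exact Submodule.zero_mem _
  | tmul y s =>
    have := Submodule.smul_mem _ s (h1 y)
    rwa [smul_tmul, one_mul] at this
  | add z w hz hw => exact Submodule.add_mem _ (hz trivial) (hw trivial)

/-! ### Tensor evaluation and projectivity of `FrobHom p R R` -/

section Character

variable (p : ℕ) (R : Type u) [CommRing R] [ExpChar R p]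

/-- The tensor evaluation map, sending `χ ⊗ s` to the character `θ ↦ χ (θ s)`. -/
def frobTensorCharacter : FrobTensor p R (CharacterModule R) →ₗ[R]
    CharacterModule (FrobHom p R R) :=
  FrobTensor.lift
    (AddMonoidHom.mk' (fun χ : CharacterModule R =>
      (AddMonoidHom.mk' (fun θ : FrobHom p R R => χ (FrobHom.eval p R R θ 1))
        fun θ η => by rw [FrobHom.add_eval, map_add] : CharacterModule (FrobHom p R R)))
      fun χ ξ => rfl)
    fun r χ => by
      refine CharacterModule.ext _ fun θ => ?_
      change χ (r • FrobHom.eval p R R θ 1) = χ (FrobHom.eval p R R (r ^ p • θ) 1)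
      rw [FrobHom.eval_smul, ← FrobHom.eval_pow_mul, mul_comm]

variable {p R}

theorem frobTensorCharacter_tmul (χ : CharacterModule R) (s : R) (θ : FrobHom p R R) :
    frobTensorCharacter p R (FrobTensor.tmul p R _ χ s) θ = χ (FrobHom.eval p R R θ s) := by
  change χ (FrobHom.eval p R R (s • θ) 1) = _
  rw [FrobHom.eval_smul, one_mul]

theorem frobTensorCharacter_sum {n : ℕ} (χ : Fin n → CharacterModule R) (s : Fin n → R)
    (θ : FrobHom p R R) :
    frobTensorCharacter p R (∑ i, FrobTensor.tmul p R _ (χ i) (s i)) θ =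
      ∑ i, χ i (FrobHom.eval p R R θ (s i)) := by
  rw [map_sum]
  refine (AddMonoidHom.finsetSum_apply _ _ _).trans ?_
  exact Finset.sum_congr rfl fun i _ => frobTensorCharacter_tmul _ _ _

theorem CharacterModule.apply_pi {n : ℕ} (Λ : CharacterModule (Fin n → R)) (v : Fin n → R) :
    Λ v = ∑ i, Λ (Pi.single i (v i)) := by
  rw [← map_sum, Finset.univ_sum_single]

/-- Evaluation at generators `s i` embeds `FrobHom p R R` in `Rⁿ`, so a character of it extends to
`Rⁿ`, where characters are sums of characters of the coordinates. -/
theorem frobTensorCharacter_surjective (hfin : IsFFinite p R) :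
    Function.Surjective (frobTensorCharacter p R) := by
  have : Module.Finite R (FrobBimodule p R) := hfin
  obtain ⟨n, s, hs⟩ := Module.Finite.exists_fin (R := R) (M := FrobBimodule p R)
  intro ξ
  let s' : Fin n → R := s
  let ι : FrobHom p R R →+ (Fin n → R) :=
    AddMonoidHom.mk' (fun θ i => FrobHom.eval p R R θ (s' i)) fun _ _ => rfl
  have hι : Function.Injective ι.toIntLinearMap := fun θ η h =>
    LinearMap.ext_on_range (f := (θ : FrobBimodule p R →ₗ[R] R)) (g := η) hs
      fun i => congrFun h i
  obtain ⟨Λ, rfl⟩ := CharacterModule.dual_surjective_of_injective ι.toIntLinearMap hι ξ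
  refine ⟨∑ i, FrobTensor.tmul p R (CharacterModule R)
    (CharacterModule.dual (LinearMap.single R (fun _ : Fin n => R) i) Λ) (s' i), ?_⟩
  refine CharacterModule.ext _ fun θ => ?_
  rw [frobTensorCharacter_sum]
  exact (CharacterModule.apply_pi Λ (ι θ)).symm

/-- Choose a finite presentation of the bimodule with generators `s i` and relations `ρ j`. If
`∑ i, χ i ⊗ s i` is mapped to zero, then `v ↦ ∑ i, χ i (v i)` vanishes on the kernel of the
transposed relation matrix `D`, so it factors through `D`. Thus each `χ i` is a combination of the
`ρ j i`, and the relations show that the tensor is zero. -/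
theorem frobTensorCharacter_injective [IsNoetherianRing R] (hfin : IsFFinite p R) :
    Function.Injective (frobTensorCharacter p R) := by
  have : Module.Finite R (FrobBimodule p R) := hfin
  obtain ⟨n, ψ, hψ⟩ := Module.Finite.exists_fin' R (FrobBimodule p R)
  obtain ⟨m, ρ, hρ⟩ := Submodule.fg_iff_exists_fin_generating_family.mp
    (IsNoetherian.noetherian (LinearMap.ker ψ))
  let s : Fin n → R := fun i => (FrobBimodule.of p R).symm (ψ (Pi.single i 1))
  have hψs (c : Fin n → R) : (FrobBimodule.of p R).symm (ψ c) = ∑ i, c i ^ p * s i := by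
    conv_lhs => rw [pi_eq_sum_univ' c]
    rw [map_sum, map_sum]
    refine Finset.sum_congr rfl fun i _ => ?_
    rw [map_smul]
    rfl
  have hform (z : FrobTensor p R (CharacterModule R)) : ∃ χ : Fin n → CharacterModule R,
      z = ∑ i, FrobTensor.tmul p R _ (χ i) (s i) := by
    induction z using FrobTensor.induction_on with
    | zero =>
      refine ⟨0, (Finset.sum_eq_zero fun i _ => ?_).symm⟩
      exact TensorProduct.zero_tmul _ (FrobBimodule.of p R (s i))
    | tmul χ t =>
      obtain ⟨c, hc⟩ := hψ (FrobBimodule.of p R t)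
      refine ⟨fun i => c i • χ, ?_⟩
      have ht : t = ∑ i, c i ^ p * s i := by rw [← hψs, hc, RingEquiv.symm_apply_apply]
      simp_rw [FrobTensor.tmul_smul]
      rw [ht]
      exact (TensorProduct.tmul_sum χ Finset.univ
        fun i => FrobBimodule.of p R (c i ^ p * s i))
    | add z w hz hw =>
      obtain ⟨χ, rfl⟩ := hz
      obtain ⟨ξ, rfl⟩ := hw
      exact ⟨χ + ξ, by simp [FrobTensor.add_tmul, Finset.sum_add_distrib]⟩
  refine (injective_iff_map_eq_zero _).mpr fun z hz => ?_
  obtain ⟨χ, rfl⟩ := hform z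
  -- The kernel of `D` consists of the vectors `(θ (s i))` for `θ` in `FrobHom p R R`.
  let D : (Fin n → R) →ₗ[R] (Fin m → R) := (Matrix.of ρ).mulVecLin
  let Λ : CharacterModule (Fin n → R) :=
    ∑ i, CharacterModule.dual (LinearMap.proj (R := R) (φ := fun _ : Fin n => R) i) (χ i)
  have hΛv (v : Fin n → R) : Λ v = ∑ i, χ i (v i) := AddMonoidHom.finsetSum_apply _ _ _
  have hΛ : ∀ v ∈ LinearMap.ker D, Λ v = 0 := by
    intro v hv
    have hker : LinearMap.ker ψ ≤ LinearMap.ker (Fintype.linearCombination R v) := by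
      rw [← hρ, Submodule.span_le]
      rintro _ ⟨j, rfl⟩
      have := congrFun (LinearMap.mem_ker.mp hv) j
      simpa [D, Matrix.mulVec, dotProduct, Fintype.linearCombination_apply] using this
    let θ : FrobBimodule p R →ₗ[R] R := (LinearMap.ker ψ).liftQ _ hker ∘ₗ
      (LinearMap.quotKerEquivOfSurjective ψ hψ).symm.toLinearMap
    have hθ (i : Fin n) : FrobHom.eval p R R θ (s i) = v i := by
      change (LinearMap.ker ψ).liftQ _ hker
        ((LinearMap.quotKerEquivOfSurjective ψ hψ).symm (ψ (Pi.single i 1))) = v i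
      have : (LinearMap.quotKerEquivOfSurjective ψ hψ).symm (ψ (Pi.single i 1)) =
          Submodule.Quotient.mk (Pi.single i 1) := by
        rw [LinearEquiv.symm_apply_eq]
        rfl
      rw [this, Submodule.liftQ_apply, Fintype.linearCombination_apply_single, one_smul]
    rw [hΛv]
    have h0 := frobTensorCharacter_sum χ s θ
    simp_rw [hθ] at h0
    rw [← h0, hz]
    rfl
  obtain ⟨μ, hμ⟩ := CharacterModule.dual_surjective_of_injective
    ((LinearMap.ker D).liftQ D le_rfl)
    (LinearMap.ker_eq_bot.mp (Submodule.ker_liftQ_eq_bot _ _ _ le_rfl))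
    (QuotientAddGroup.lift (LinearMap.ker D).toAddSubgroup Λ hΛ)
  have hμD (v : Fin n → R) : μ (D v) = Λ v :=
    DFunLike.congr_fun hμ (Submodule.Quotient.mk v)
  let μ' : Fin m → CharacterModule R := fun j =>
    CharacterModule.dual (LinearMap.single R (fun _ : Fin m => R) j) μ
  have hχ (i : Fin n) : χ i = ∑ j, ρ j i • μ' j := by
    refine CharacterModule.ext _ fun r => ?_
    have h1 : Λ (Pi.single i r) = χ i r := by
      rw [hΛv, Finset.sum_eq_single i]
      · simp
      · intro k _ hk
        simp [hk]
      · simp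
    rw [← h1, ← hμD, CharacterModule.apply_pi]
    refine Eq.trans ?_ (AddMonoidHom.finsetSum_apply _ _ _).symm
    refine Finset.sum_congr rfl fun j _ => ?_
    change _ = μ (Pi.single j (ρ j i • r))
    simp [D]
  have hρ0 (j : Fin m) : ∑ i, ρ j i ^ p * s i = 0 := by
    have : ρ j ∈ LinearMap.ker ψ := hρ ▸ Submodule.subset_span ⟨j, rfl⟩
    rw [← hψs, LinearMap.mem_ker.mp this, map_zero]
  have hsum (i : Fin n) : FrobTensor.tmul p R _ (χ i) (s i) =
      ∑ j, FrobTensor.tmul p R _ (μ' j) (ρ j i ^ p * s i) := by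
    rw [hχ]
    simp_rw [← FrobTensor.tmul_smul]
    exact TensorProduct.sum_tmul _ _ _
  simp_rw [hsum]
  rw [Finset.sum_comm]
  refine Finset.sum_eq_zero fun j _ => ?_
  refine (TensorProduct.tmul_sum (μ' j) Finset.univ
    fun i => FrobBimodule.of p R (ρ j i ^ p * s i)).symm.trans ?_
  rw [← map_sum, hρ0, map_zero]
  exact TensorProduct.tmul_zero _ _

theorem FrobHom.projective_self [IsNoetherianRing R] (hfin : IsFFinite p R)
    (hFPI : IsFPI p R) : Module.Projective R (FrobHom p R R) := by
  have hflat : Module.Flat R (FrobHom p R R) := by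
    rw [Module.Flat.iff_characterModule_injective]
    have h1 : Module.Injective R (FrobTensor p R (CharacterModule R)) :=
      hFPI _ (Module.Flat.iff_characterModule_injective.mp inferInstance)
    exact ((Module.Baer.of_injective h1).of_equiv (LinearEquiv.ofBijective _
      ⟨frobTensorCharacter_injective hfin, frobTensorCharacter_surjective hfin⟩)).injective
  have := FrobHom.finite_self hfin
  have : Module.FinitePresentation R (FrobHom p R R) :=
    Module.finitePresentation_of_finite R _
  exact Module.Flat.projective_of_finitePresentation

end Character

/-! ### Reflexivity -/

/-- If `W` is a direct summand of `Rⁿ`, then `Hom(Y, W)` is a direct summand of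
`Hom(Y, Rⁿ) = (Yⁿ)*`. -/
theorem Module.IsReflexive.linearMap_of_projective {R : Type*} [CommRing R] {Y W : Type*}
    [AddCommGroup Y] [Module R Y] [AddCommGroup W] [Module R W] [Module.Finite R W]
    [Module.Projective R W] (h : ∀ n : ℕ, Module.IsReflexive R (Dual R (Fin n → Y))) :
    Module.IsReflexive R (Y →ₗ[R] W) := by
  obtain ⟨n, f, hf⟩ := Module.Finite.exists_fin' R W
  obtain ⟨g, hg⟩ := Module.projective_lifting_property f .id hf
  have := h n
  refine .of_split (M := Dual R (Fin n → Y))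
    { toFun := fun h => ∑ k, LinearMap.proj k ∘ₗ g ∘ₗ h ∘ₗ LinearMap.proj k
      map_add' := fun h h' => by
        simp only [LinearMap.add_comp, LinearMap.comp_add, Finset.sum_add_distrib]
      map_smul' := fun r h => by
        simp only [LinearMap.smul_comp, LinearMap.comp_smul, Finset.smul_sum, RingHom.id_apply] }
    { toFun := fun ξ => f ∘ₗ LinearMap.pi fun k => ξ ∘ₗ LinearMap.single R (fun _ => Y) k
      map_add' := fun ξ ξ' => by
        ext y
        simp only [LinearMap.comp_apply, LinearMap.add_apply, ← map_add]
        rfl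
      map_smul' := fun r ξ => by
        ext y
        exact map_smul f r _ } ?_
  ext h y
  have h1 : (fun k => (g (h y)) k) = g (h y) := rfl
  have h2 (k : Fin n) : ∑ j, g (h ((Pi.single k y : Fin n → Y) j)) j = g (h y) k := by
    rw [Finset.sum_eq_single k]
    · simp
    · intro j _ hj
      simp [hj]
    · simp
  have h3 := LinearMap.congr_fun hg (h y)
  simp only [LinearMap.comp_apply, LinearMap.id_apply] at h3
  rw [LinearMap.comp_apply, LinearMap.id_apply]
  refine Eq.trans (congrArg f (funext fun k => ?_)) h3
  refine Eq.trans ?_ (h2 k)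
  simp

/-- For reflexive `M`, the tensor-hom adjunction and `M = M**` make `FrobHom p R M` a retract of
`Hom(FrobTensor p R M*, FrobHom p R R)`: an element `θ` corresponds to
`x ⊗ s ↦ (t ↦ x (θ (t * s)))`. -/
theorem FrobHom.isReflexive_of_hom {p : ℕ} {R : Type u} [CommRing R] [ExpChar R p] (M : Type v)
    [AddCommGroup M] [Module R M] [Module.IsReflexive R M]
    [Module.IsReflexive R (FrobTensor p R (Dual R M) →ₗ[R] FrobHom p R R)] :
    Module.IsReflexive R (FrobHom p R M) := by
  let α (θ : FrobHom p R M) : FrobTensor p R (Dual R M) →ₗ[R] FrobHom p R R :=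
    FrobTensor.lift
      (AddMonoidHom.mk' (fun x : Dual R M => FrobHom.map x θ) fun x y => rfl)
      fun r x => FrobHom.ext fun s => by
        change r • x (FrobHom.eval p R M θ s) = FrobHom.eval p R R (r ^ p • FrobHom.map x θ) s
        rw [FrobHom.eval_smul, mul_comm, FrobHom.eval_pow_mul, FrobHom.eval_map]
  have hα (θ : FrobHom p R M) (x : Dual R M) (s : R) :
      α θ (FrobTensor.tmul p R _ x s) = s • FrobHom.map x θ := rfl
  have hα_ext {g h : FrobTensor p R (Dual R M) →ₗ[R] FrobHom p R R}
      (hgh : ∀ x s, g (FrobTensor.tmul p R _ x s) = h (FrobTensor.tmul p R _ x s)) : g = h := by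
    ext z
    induction z using FrobTensor.induction_on with
    | zero => rw [map_zero, map_zero]
    | tmul x s => exact hgh x s
    | add z w hz hw => rw [map_add, map_add, hz, hw]
  let γ (h : FrobTensor p R (Dual R M) →ₗ[R] FrobHom p R R) (s : R) : Dual R (Dual R M) :=
    { toFun := fun x => FrobHom.eval p R R (h (FrobTensor.tmul p R _ x s)) 1
      map_add' := fun x y => by rw [FrobTensor.add_tmul, map_add, FrobHom.add_eval]
      map_smul' := fun r x => by
        rw [FrobTensor.tmul_smul, mul_comm, ← FrobTensor.smul_tmul, map_smul, FrobHom.eval_smul,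
          mul_comm, FrobHom.eval_pow_mul, RingHom.id_apply] }
  have hγ (h s x) : γ h s x = FrobHom.eval p R R (h (FrobTensor.tmul p R _ x s)) 1 := rfl
  let β (h : FrobTensor p R (Dual R M) →ₗ[R] FrobHom p R R) : FrobHom p R M :=
    FrobHom.mk (AddMonoidHom.mk' (fun s => (evalEquiv R M).symm (γ h s)) fun s t => by
        rw [← map_add]
        congr 1
        ext x
        rw [LinearMap.add_apply, hγ, hγ, hγ, FrobTensor.tmul_add, map_add, FrobHom.add_eval])
      fun r s => by
        change (evalEquiv R M).symm (γ h (r ^ p * s)) = r • (evalEquiv R M).symm (γ h s)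
        rw [← map_smul]
        congr 1
        ext x
        rw [LinearMap.smul_apply, ← map_smul, hγ, hγ, FrobTensor.tmul_smul]
  have hβ (h s) : FrobHom.eval p R M (β h) s = (evalEquiv R M).symm (γ h s) := rfl
  refine .of_split (M := FrobTensor p R (Dual R M) →ₗ[R] FrobHom p R R)
    { toFun := α
      map_add' := fun θ η => hα_ext fun x s => by
        rw [LinearMap.add_apply, hα, hα, hα, map_add, smul_add]
      map_smul' := fun r θ => hα_ext fun x s => by
        rw [RingHom.id_apply, LinearMap.smul_apply, hα, hα, map_smul, smul_comm] }
    { toFun := β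
      map_add' := fun g h => FrobHom.ext fun s => by
        rw [FrobHom.add_eval, hβ, hβ, hβ, ← map_add]
        rfl
      map_smul' := fun r h => FrobHom.ext fun s => by
        rw [RingHom.id_apply, FrobHom.eval_smul, hβ, hβ]
        congr 1
        ext x
        rw [hγ, hγ, LinearMap.smul_apply, ← map_smul, FrobTensor.smul_tmul] } ?_
  refine LinearMap.ext fun θ => FrobHom.ext fun s => ?_
  change (evalEquiv R M).symm (γ (α θ) s) = FrobHom.eval p R M θ s
  rw [LinearEquiv.symm_apply_eq]
  ext x
  rw [hγ, hα, FrobHom.eval_smul, FrobHom.eval_map, one_mul]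
  rfl

theorem IsFPI.isReflexive_frobHom {p : ℕ} [Fact p.Prime] {R : Type u} [CommRing R]
    [IsNoetherianRing R] [CharP R p] (hfin : IsFFinite p R) (hFPI : IsFPI p R) (M : Type v)
    [AddCommGroup M] [Module R M] [Module.Finite R M] [Module.IsReflexive R M] :
    Module.IsReflexive R (FrobHom p R M) := by
  have := FrobHom.finite_self hfin
  have := FrobHom.projective_self hfin hFPI
  have : Module.Finite R (FrobTensor p R (Dual R M)) := FrobTensor.finite
  have : Module.IsReflexive R (FrobTensor p R (Dual R M) →ₗ[R] FrobHom p R R) :=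
    Module.IsReflexive.linearMap_of_projective fun n =>
      Module.IsReflexive.dual_of_injective_localization
        (fun P _ hP => hP.injective_localization hFPI _) _
  exact FrobHom.isReflexive_of_hom M

end

end

theorem mainTheorem6 (p : ℕ) [Fact p.Prime] (R : Type u) [CommRing R] [IsNoetherianRing R]
    [CharP R p] (hfin : IsFFinite p R) (hFPI : IsFPI p R) :
    (∀ (M : Type v) [AddCommGroup M] [Module R M] [Module.Finite R M],
      Module.IsReflexive R M → Module.IsReflexive R (FrobHom p R M)) ∧
    IsFTildePR p R :=
  ⟨fun M _ _ _ _ => hFPI.isReflexive_frobHom hfin M,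
    hfin, fun M _ _ _ _ => hFPI.isReflexive_frobHom hfin M⟩
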